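/- Let \(q_n\in\mathbb R\) and \(\rho_n>0\) \((n\ge 1)\) be the diagonal and off-diagonal entries of a semi-infinite Jacobi matrix. Let \(P_n(\lambda)\) and \(Q_n(\lambda)\) be its orthogonal polynomials of the first and second kind, i.e. the solutions of \(\rho_{n-1}u_{n-1}+q_nu_n+\rho_nu_{n+1}=\lambda u_n\) with \(P_0=0\), \(P_1=1\) (recurrence for \(n\ge1\)) and \(Q_1=0\), \(Q_2=1/\rho_1\) (recurrence for \(n\ge2\)). Assume that, as \(n\to\infty\), \[ P_n(0)^2+Q_n(0)^2\sim C\,n^{\Delta-D},\qquad \rho_n\sim c\,n^{D}, \] with constants \(C,c>0\) and real numbers \(\Delta,D\) satisfying \(1<\Delta<D-1\); here \(x_n\sim y_n\) means \(x_n/y_n\to1\). Then the numbers \(\delta_n:=P_n(0)^2+Q_n(0)^2\) are summable (the matrix is limit-circle), and the order of the matrix is at most \(1/D\). The order is defined as that of the corresponding canonical system: put \(b_n=\delta_1+\dots+\delta_n\), \(L=\sum_{n\ge1}\delta_n\), \(e_n=\delta_n^{-1/2}\,(P_n(0),-Q_n(0))^{T}\), and let \(\mathcal H(x)=\langle\cdot,e_n\rangle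 e_n\) for \(x\in(b_{n-1},b_n)\), \(n\ge1\). The canonical system \(J\,\frac{dY}{dx}=z\mathcal H Y\) on \([0,L]\), \(J=\begin{pmatrix}0&-1\\1&0\end{pmatrix}\), has a monodromy matrix \(M(x,z)\), that is, a matrix solution with \(M(0,z)=I\), and every entry of \(M(L,z)\) satisfies \[ \limsup_{|z|\to\infty}\frac{\log^+\log^+|M_{ij}(L,z)|}{\log|z|}\le\frac1D,\qquad i,j\in\{1,2\}. \] -/

import Mathlib

open Filter Asymptotics
open scoped Real

noncomputable section

/-- The order of growth of a function on the complex plane,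
`limsup_{|z| → ∞} log log |f z| / log |z|`, as an extended real number. The positive parts of the
logarithms are taken, so that the values of `z` for which `|f z|` is small play no role. -/
def growthOrder (f : ℂ → ℂ) : EReal :=
  limsup (fun z : ℂ => ((log⁺ (log⁺ ‖f z‖) / Real.log ‖z‖ : ℝ) : EReal)) (Bornology.cobounded ℂ)

namespace CanonicalSystem

/-- The symplectic matrix `J`. -/
def J : Matrix (Fin 2) (Fin 2) ℂ := !![0, -1; 1, 0]

/-- `M` is the monodromy matrix of the canonical system `J dY/dx = z H Y` on `[0, L]`: for every
complex `z`, `x ↦ M x z` is the solution with `M 0 z = 1`. Solutions are understood in the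
Carathéodory sense, that is, as continuous solutions of the integrated equation
`Y x = Y 0 - z ∫₀ˣ J H Y` (recall that `J⁻¹ = -J`). -/
structure IsMonodromyMatrix (H : ℝ → Matrix (Fin 2) (Fin 2) ℝ) (L : ℝ)
    (M : ℝ → ℂ → Matrix (Fin 2) (Fin 2) ℂ) : Prop where
  continuousOn : ∀ z : ℂ, ContinuousOn (fun x => M x z) (Set.Icc 0 L)
  intervalIntegrable : ∀ (z : ℂ) (i j : Fin 2), IntervalIntegrable
    (fun t => (J * (H t).map Complex.ofReal * M t z) i j) MeasureTheory.volume 0 L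
  integral_eq : ∀ (z : ℂ), ∀ x ∈ Set.Icc (0 : ℝ) L, ∀ i j : Fin 2,
    M x z i j = (1 : Matrix (Fin 2) (Fin 2) ℂ) i j
      - z * ∫ t in (0 : ℝ)..x, (J * (H t).map Complex.ofReal * M t z) i j

end CanonicalSystem

/-- A (semi-infinite, real) Jacobi matrix with diagonal `q 1, q 2, …` and off-diagonal
`ρ 1, ρ 2, …`, all `ρ n` positive. The values `q 0` and `ρ 0` are not used. -/
structure JacobiMatrix where
  /-- the diagonal entries -/
  q : ℕ → ℝ
  /-- the off-diagonal entries -/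
  ρ : ℕ → ℝ
  ρ_pos : ∀ n, 1 ≤ n → 0 < ρ n

namespace JacobiMatrix

open Polynomial

variable (A : JacobiMatrix)

/-- Orthogonal polynomials of the first kind: the solution of
`ρ (n-1) * u (n-1) + q n * u n + ρ n * u (n+1) = λ * u n` with `P 0 = 0`, `P 1 = 1`. -/
def P : ℕ → ℝ[X]
  | 0 => 0
  | 1 => 1
  | n + 2 => C (A.ρ (n + 1))⁻¹ *
      ((X - C (A.q (n + 1))) * P (n + 1) - C (A.ρ n) * P n)

/-- Orthogonal polynomials of the second kind: the solution of the same recurrence for `n ≥ 2`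
with `Q 1 = 0`, `Q 2 = 1 / ρ 1`. (The value at index `0` is a dummy.) -/
def Q : ℕ → ℝ[X]
  | 0 => 0
  | 1 => 0
  | 2 => C (A.ρ 1)⁻¹
  | n + 3 => C (A.ρ (n + 2))⁻¹ *
      ((X - C (A.q (n + 2))) * Q (n + 2) - C (A.ρ (n + 1)) * Q (n + 1))

/-- `δ n = P_n(0)² + Q_n(0)²`. -/
def δ (n : ℕ) : ℝ := ((A.P n).eval 0) ^ 2 + ((A.Q n).eval 0) ^ 2

/-- The break points `b n = δ 1 + ⋯ + δ n`. -/
def b (n : ℕ) : ℝ := ∑ j ∈ Finset.range n, A.δ (j + 1)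

/-- The length `L = lim b n` of the interval of the canonical system of a limit-circle matrix. -/
def L : ℝ := ∑' j : ℕ, A.δ (j + 1)

/-- The unit vector `e n = (P_n(0), -Q_n(0)) / √(δ n)`. With this sign, if `u` solves the recurrence
with spectral parameter `z` and `u = α_n P(0) + β_n Q(0)` at the indices `n` and `n + 1`, then
`(α_n, -β_n)` are the values at `b n` of a solution of the canonical system. -/
def e (n : ℕ) : Fin 2 → ℝ :=
  ![(A.P n).eval 0 / √(A.δ n), -(A.Q n).eval 0 / √(A.δ n)]

/-- The Hamiltonian of the canonical system corresponding to the Jacobi matrix: it equals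
`⟨·, e n⟩ e n` on the interval `(b (n-1), b n)`, `n ≥ 1`. -/
def hamiltonian (x : ℝ) : Matrix (Fin 2) (Fin 2) ℝ :=
  ∑ᶠ n : ℕ, (Set.Ioo (A.b n) (A.b (n + 1))).indicator
    (fun _ => Matrix.vecMulVec (A.e (n + 1)) (A.e (n + 1))) x

end JacobiMatrix

end

noncomputable section

open Set MeasureTheory Matrix

namespace CanonicalSystem

/-! On each piece the coefficient `J H` is constant and nilpotent, so the solution is affine there.
The monodromy matrix is therefore the limit of the products `transfer` of explicit shears
(`IsMonodromyMatrix.apply_breakPoint`), and only the growth of these products matters.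

In the orthonormal frame of the `n`-th piece, crossing the piece is a shear of size `|z| d n`, and
passing to the next frame is a rotation whose sine is `turn v n`. In a norm with weight `τ ≤ 1` on
the component orthogonal to `v n`, the shear costs at most `1 + τ |z| d n` and the rotation at most
`1 + |turn v n| / τ` (`frameNorm_succ_le`).

Take `|z| ≤ N ^ D`, angles `O(n ^ (-Δ))` and lengths `O(n ^ (Δ - D))`. With `τ = N ^ (-Δ)` the
logarithmic costs of rotations and shears beyond `N` both sum to `O(N)`, while the first `N` pieces
cost `O(log N)` each (`norm_transfer_add_ceil_le`). With `N` about `|z| ^ (1 / D)` this gives `log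
|M| = O(|z| ^ (1 / D) log |z|)`, hence order at most `1 / D`.

For a Jacobi matrix the lengths are the `δ n`, and the Wronskian identity expresses the sines
through `ρ` and `δ` (`turn_e`), which yields the decay `n ^ (-Δ)`. -/

/-- A finite sum of indicators of successive intervals, evaluated inside one of them. -/
lemma finsum_indicator_Ioo_succ {E : Type*} [AddCommMonoid E] {b : ℕ → ℝ} (hb : Monotone b)
    (F : ℕ → E) {n : ℕ} {x : ℝ} (hx : x ∈ Ioo (b n) (b (n + 1))) :
    ∑ᶠ k, (Ioo (b k) (b (k + 1))).indicator (fun _ => F k) x = F n := by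
  rw [finsum_eq_single _ n, indicator_of_mem hx]
  intro k hk
  refine indicator_of_notMem (fun hxk => ?_) _
  exact (disjoint_left.1 (hb.pairwise_disjoint_on_Ioo_succ hk)) hxk hx

/-! ### Step Hamiltonians, break points and transfer matrices. -/

/-- The `n`-th break point of a step Hamiltonian with piece lengths `d`. -/
def breakPoint (d : ℕ → ℝ) (n : ℕ) : ℝ := ∑ k ∈ Finset.range n, d k

/-- The Hamiltonian equal to `⟨·, v n⟩ v n` on the `n`-th of successive intervals of lengths `d`. -/
def stepHamiltonian (v : ℕ → Fin 2 → ℝ) (d : ℕ → ℝ) (x : ℝ) : Matrix (Fin 2) (Fin 2) ℝ :=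
  ∑ᶠ n : ℕ, (Ioo (breakPoint d n) (breakPoint d (n + 1))).indicator
    (fun _ => vecMulVec (v n) (v n)) x

/-- The matrix `J ⟨·, v n⟩ v n`. -/
def generator (v : ℕ → Fin 2 → ℝ) (n : ℕ) : Matrix (Fin 2) (Fin 2) ℂ :=
  J * (vecMulVec (v n) (v n)).map Complex.ofReal

/-- The value at the `n`-th break point of the solution equal to `1` at `0`. -/
def transfer (v : ℕ → Fin 2 → ℝ) (d : ℕ → ℝ) (z : ℂ) : ℕ → Matrix (Fin 2) (Fin 2) ℂ
  | 0 => 1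
  | n + 1 => transfer v d z n - (z * d n) • (generator v n * transfer v d z n)

/-- The function `J H M` of the solution `M`, defined through the transfer matrices. -/
def velocity (v : ℕ → Fin 2 → ℝ) (d : ℕ → ℝ) (z : ℂ) (t : ℝ) : Matrix (Fin 2) (Fin 2) ℂ :=
  ∑ᶠ n : ℕ, (Ioo (breakPoint d n) (breakPoint d (n + 1))).indicator
    (fun _ => generator v n * transfer v d z n) t

variable {v : ℕ → Fin 2 → ℝ} {d : ℕ → ℝ}

lemma generator_eq (v : ℕ → Fin 2 → ℝ) (n : ℕ) : generator v n =
    !![-((v n 1 : ℂ) * v n 0), -((v n 1 : ℂ) * v n 1);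
      (v n 0 : ℂ) * v n 0, (v n 0 : ℂ) * v n 1] := by
  ext i j
  rw [generator, Matrix.mul_apply, Fin.sum_univ_two, Matrix.map_apply, Matrix.map_apply,
    vecMulVec_apply, vecMulVec_apply]
  fin_cases i <;> fin_cases j <;> simp [J]

/-- `J` is skew, so `J v` is orthogonal to `v` and `J v vᵀ` squares to zero. Hence the exponential
over a piece is exactly the factor used in `transfer`. -/
lemma generator_mul_self (v : ℕ → Fin 2 → ℝ) (n : ℕ) : generator v n * generator v n = 0 := by
  rw [generator_eq]
  ext i j
  fin_cases i <;> fin_cases j <;> simp [Matrix.mul_apply, Fin.sum_univ_two] <;> ring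

lemma generator_mul_apply_zero (v : ℕ → Fin 2 → ℝ) (n : ℕ) (Y : Matrix (Fin 2) (Fin 2) ℂ)
    (j : Fin 2) :
    (generator v n * Y) 0 j = -(v n 1 * (v n 0 * Y 0 j + v n 1 * Y 1 j)) := by
  rw [generator_eq, Matrix.mul_apply, Fin.sum_univ_two]
  simp only [of_apply, cons_val', cons_val_zero, cons_val_one, cons_val_fin_one]
  ring

lemma generator_mul_apply_one (v : ℕ → Fin 2 → ℝ) (n : ℕ) (Y : Matrix (Fin 2) (Fin 2) ℂ)
    (j : Fin 2) :
    (generator v n * Y) 1 j = v n 0 * (v n 0 * Y 0 j + v n 1 * Y 1 j) := by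
  rw [generator_eq, Matrix.mul_apply, Fin.sum_univ_two]
  simp only [of_apply, cons_val', cons_val_zero, cons_val_one, cons_val_fin_one]
  ring

lemma breakPoint_zero (d : ℕ → ℝ) : breakPoint d 0 = 0 := by simp [breakPoint]

lemma breakPoint_succ (d : ℕ → ℝ) (n : ℕ) : breakPoint d (n + 1) = breakPoint d n + d n := by
  simp [breakPoint, Finset.sum_range_succ]

lemma breakPoint_strictMono (hd : ∀ n, 0 < d n) : StrictMono (breakPoint d) :=
  strictMono_nat_of_lt_succ fun n => by rw [breakPoint_succ]; linarith [hd n]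

lemma breakPoint_nonneg (hd : ∀ n, 0 < d n) (n : ℕ) : 0 ≤ breakPoint d n :=
  Finset.sum_nonneg fun k _ => (hd k).le

lemma breakPoint_le_tsum (hd : ∀ n, 0 < d n) (hs : Summable d) (n : ℕ) :
    breakPoint d n ≤ ∑' k, d k :=
  hs.sum_le_tsum _ fun k _ => (hd k).le

lemma tendsto_breakPoint (hs : Summable d) :
    Tendsto (breakPoint d) atTop (nhds (∑' k, d k)) :=
  hs.hasSum.tendsto_sum_nat

lemma exists_mem_Ioo_breakPoint (hs : Summable d) {t : ℝ} (ht : t ∈ Ioo 0 (∑' k, d k))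
    (hne : t ∉ range (breakPoint d)) :
    ∃ n, t ∈ Ioo (breakPoint d n) (breakPoint d (n + 1)) := by
  have hex : ∃ n, t < breakPoint d n :=
    ((tendsto_breakPoint hs).eventually (lt_mem_nhds ht.2)).exists
  classical
  obtain ⟨m, hm⟩ : ∃ m, Nat.find hex = m + 1 := by
    refine Nat.exists_eq_succ_of_ne_zero fun h => ?_
    have := Nat.find_spec hex
    rw [h, breakPoint_zero] at this
    exact absurd ht.1 (not_lt.2 this.le)
  refine ⟨m, lt_of_le_of_ne ?_ (fun h => hne ⟨m, h⟩), hm ▸ Nat.find_spec hex⟩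
  exact not_lt.1 (Nat.find_min hex (by omega))

lemma stepHamiltonian_eq (hd : ∀ n, 0 < d n) {n : ℕ} {x : ℝ}
    (hx : x ∈ Ioo (breakPoint d n) (breakPoint d (n + 1))) :
    stepHamiltonian v d x = vecMulVec (v n) (v n) :=
  finsum_indicator_Ioo_succ (breakPoint_strictMono hd).monotone (fun n => vecMulVec (v n) (v n)) hx

lemma velocity_eq (hd : ∀ n, 0 < d n) {z : ℂ} {n : ℕ} {x : ℝ}
    (hx : x ∈ Ioo (breakPoint d n) (breakPoint d (n + 1))) :
    velocity v d z x = generator v n * transfer v d z n :=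
  finsum_indicator_Ioo_succ (breakPoint_strictMono hd).monotone
    (fun n => generator v n * transfer v d z n) hx

/-! ### Uniqueness at the break points. -/

/-- A monodromy matrix takes the values of the transfer matrices at the break points. -/
lemma IsMonodromyMatrix.apply_breakPoint (hd : ∀ n, 0 < d n) (hs : Summable d)
    {M : ℝ → ℂ → Matrix (Fin 2) (Fin 2) ℂ}
    (hM : IsMonodromyMatrix (stepHamiltonian v d) (∑' k, d k) M) (z : ℂ) (n : ℕ) :
    M (breakPoint d n) z = transfer v d z n := by
  set G : ℝ → Matrix (Fin 2) (Fin 2) ℂ :=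
    fun t => J * (stepHamiltonian v d t).map Complex.ofReal * M t z with hG
  have hmem : ∀ n, breakPoint d n ∈ Icc 0 (∑' k, d k) := fun n =>
    ⟨breakPoint_nonneg hd n, breakPoint_le_tsum hd hs n⟩
  have hInt : ∀ x ∈ Icc 0 (∑' k, d k), ∀ y ∈ Icc 0 (∑' k, d k), ∀ i j,
      IntervalIntegrable (fun t => G t i j) volume x y := fun x hx y hy i j =>
    (hM.intervalIntegrable z i j).mono_set (by
      rw [uIcc_of_le (hx.1.trans hx.2)]; exact uIcc_subset_Icc hx hy)
  have h0 : (0 : ℝ) ∈ Icc 0 (∑' k, d k) := by simpa [breakPoint_zero] using hmem 0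
  have hdiff : ∀ x ∈ Icc 0 (∑' k, d k), ∀ y ∈ Icc 0 (∑' k, d k), ∀ i j,
      M y z i j = M x z i j - z * ∫ t in x..y, G t i j := by
    intro x hx y hy i j
    rw [hM.integral_eq z x hx i j, hM.integral_eq z y hy i j,
      ← intervalIntegral.integral_add_adjacent_intervals (hInt 0 h0 x hx i j) (hInt x hx y hy i j)]
    ring
  induction n with
  | zero =>
    ext i j
    rw [breakPoint_zero, hM.integral_eq z 0 h0 i j]
    simp [transfer]
  | succ n ih =>
    set x := breakPoint d n with hx
    have hlt : x < breakPoint d (n + 1) := breakPoint_strictMono hd n.lt_succ_self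
    have hGeq : ∀ t ∈ Ioo x (breakPoint d (n + 1)), G t = generator v n * M t z := by
      intro t ht
      simp only [hG, stepHamiltonian_eq hd ht, generator]
    -- The increment of `M` along the piece lies in the range of the generator, which the generator
    -- itself annihilates; so the integrand is constant on the piece.
    have hGM : ∀ t ∈ Ioo x (breakPoint d (n + 1)),
        generator v n * M t z = generator v n * M x z := by
      intro t ht
      have htm : t ∈ Icc 0 (∑' k, d k) :=
        ⟨(hmem n).1.trans ht.1.le, ht.2.le.trans (hmem (n + 1)).2⟩
      ext i j
      have hzero : ∑ k, generator v n i k * ∫ s in x..t, G s k j = 0 := by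
        simp_rw [← intervalIntegral.integral_const_mul]
        rw [← intervalIntegral.integral_finsetSum
          (fun k _ => (hInt x (hmem n) t htm k j).const_mul _)]
        rw [intervalIntegral.integral_congr_uIoo (g := fun _ => 0), intervalIntegral.integral_zero]
        intro s hs
        rw [uIoo_of_le ht.1.le] at hs
        have h1 := hGeq s ⟨hs.1, hs.2.trans ht.2⟩
        change ∑ k, generator v n i k * G s k j = 0
        rw [← Matrix.mul_apply, h1, ← Matrix.mul_assoc, generator_mul_self, Matrix.zero_mul]
        rfl
      rw [Matrix.mul_apply, Matrix.mul_apply]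
      calc ∑ k, generator v n i k * M t z k j
          = ∑ k, generator v n i k * M x z k j
            - z * ∑ k, generator v n i k * ∫ s in x..t, G s k j := by
            rw [Finset.mul_sum, ← Finset.sum_sub_distrib]
            refine Finset.sum_congr rfl fun k _ => ?_
            rw [hdiff x (hmem n) t htm k j]; ring
        _ = _ := by rw [hzero]; ring
    ext i j
    rw [hdiff x (hmem n) _ (hmem (n + 1)) i j,
      intervalIntegral.integral_congr_uIoo (g := fun _ => (generator v n * M x z) i j)]
    · rw [intervalIntegral.integral_const, ih, transfer, hx, breakPoint_succ]
      simp only [Matrix.sub_apply, Matrix.smul_apply, add_sub_cancel_left, Complex.real_smul,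
        smul_eq_mul]
      ring
    · intro t ht
      rw [uIoo_of_le hlt.le] at ht
      simp only [hGeq t ht, hGM t ht]

/-! ### Existence of the monodromy matrix. -/

lemma norm_generator_mul_apply_le (hv : ∀ n, v n 0 ^ 2 + v n 1 ^ 2 = 1)
    (n : ℕ) (Y : Matrix (Fin 2) (Fin 2) ℂ) (i j : Fin 2) :
    ‖(generator v n * Y) i j‖ ≤ ‖Y 0 j‖ + ‖Y 1 j‖ := by
  have h0 : ‖(v n 0 : ℂ)‖ ≤ 1 := by
    rw [Complex.norm_real, Real.norm_eq_abs, ← sq_le_one_iff_abs_le_one]; nlinarith [hv n]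
  have h1 : ‖(v n 1 : ℂ)‖ ≤ 1 := by
    rw [Complex.norm_real, Real.norm_eq_abs, ← sq_le_one_iff_abs_le_one]; nlinarith [hv n]
  have hw : ‖v n 0 * Y 0 j + v n 1 * Y 1 j‖ ≤ ‖Y 0 j‖ + ‖Y 1 j‖ := by
    refine (norm_add_le _ _).trans (add_le_add ?_ ?_) <;> rw [norm_mul]
    · exact mul_le_of_le_one_left (norm_nonneg _) h0
    · exact mul_le_of_le_one_left (norm_nonneg _) h1
  fin_cases i
  · simp only [Fin.zero_eta, generator_mul_apply_zero, norm_neg, norm_mul]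
    exact (mul_le_of_le_one_left (norm_nonneg _) h1).trans hw
  · simp only [Fin.mk_one, generator_mul_apply_one, norm_mul]
    exact (mul_le_of_le_one_left (norm_nonneg _) h0).trans hw

/-- A Gronwall-type bound, uniform in `n` once the lengths are summable. It serves only to integrate
the velocity up to the endpoint; it is too weak for the order. -/
lemma norm_transfer_le (hv : ∀ n, v n 0 ^ 2 + v n 1 ^ 2 = 1)
    (hd : ∀ n, 0 < d n) (z : ℂ) (j : Fin 2) (n : ℕ) :
    ‖transfer v d z n 0 j‖ + ‖transfer v d z n 1 j‖ ≤ Real.exp (2 * ‖z‖ * breakPoint d n) := by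
  induction n with
  | zero => fin_cases j <;> simp [transfer, breakPoint_zero, Matrix.one_apply]
  | succ n ih =>
    have key : ∀ i, ‖transfer v d z (n + 1) i j‖ ≤ ‖transfer v d z n i j‖ + ‖z‖ * d n *
        (‖transfer v d z n 0 j‖ + ‖transfer v d z n 1 j‖) := by
      intro i
      simp only [transfer, Matrix.sub_apply, Matrix.smul_apply, smul_eq_mul]
      refine (norm_sub_le _ _).trans (add_le_add le_rfl ?_)
      rw [norm_mul, norm_mul, Complex.norm_real, Real.norm_of_nonneg (hd n).le]
      exact mul_le_mul_of_nonneg_left (norm_generator_mul_apply_le hv n _ i j)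
        (mul_nonneg (norm_nonneg _) (hd n).le)
    calc _ ≤ (2 * ‖z‖ * d n + 1) *
          (‖transfer v d z n 0 j‖ + ‖transfer v d z n 1 j‖) := by linarith [key 0, key 1]
      _ ≤ Real.exp (2 * ‖z‖ * d n) * Real.exp (2 * ‖z‖ * breakPoint d n) := by
          refine mul_le_mul (Real.add_one_le_exp _) ih (by positivity) (by positivity)
      _ = _ := by rw [← Real.exp_add, breakPoint_succ]; ring_nf

lemma integrableOn_velocity (hv : ∀ n, v n 0 ^ 2 + v n 1 ^ 2 = 1)
    (hd : ∀ n, 0 < d n) (hs : Summable d) (z : ℂ) (i j : Fin 2) :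
    IntegrableOn (fun t => velocity v d z t i j)
      (⋃ n, Ioo (breakPoint d n) (breakPoint d (n + 1))) := by
  have hcongr : ∀ n, EqOn (fun _ : ℝ => (generator v n * transfer v d z n) i j)
      (fun t => velocity v d z t i j) (Ioo (breakPoint d n) (breakPoint d (n + 1))) :=
    fun n t ht => by simp only [velocity_eq hd ht]
  refine integrableOn_iUnion_of_summable_integral_norm (fun n => ?_) ?_
  · exact (integrableOn_const (by simp)).congr_fun (hcongr n) measurableSet_Ioo
  · refine Summable.of_nonneg_of_le (fun n => by positivity) (fun n => ?_)
      (hs.mul_right (Real.exp (2 * ‖z‖ * ∑' k, d k)))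
    rw [setIntegral_congr_fun (g := fun _ => ‖(generator v n * transfer v d z n) i j‖)
      measurableSet_Ioo (fun t ht => by simp only [velocity_eq hd ht])]
    rw [setIntegral_const, Real.volume_real_Ioo_of_le (breakPoint_strictMono hd n.lt_succ_self).le,
      breakPoint_succ, add_sub_cancel_left, smul_eq_mul]
    refine mul_le_mul_of_nonneg_left ?_ (hd n).le
    refine (norm_generator_mul_apply_le hv n _ i j).trans ((norm_transfer_le hv hd z j n).trans ?_)
    exact Real.exp_le_exp.2
      (mul_le_mul_of_nonneg_left (breakPoint_le_tsum hd hs n) (by positivity))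

lemma intervalIntegrable_velocity (hv : ∀ n, v n 0 ^ 2 + v n 1 ^ 2 = 1)
    (hd : ∀ n, 0 < d n) (hs : Summable d) (z : ℂ) (i j : Fin 2) :
    IntervalIntegrable (fun t => velocity v d z t i j) volume 0 (∑' k, d k) := by
  rw [intervalIntegrable_iff_integrableOn_Ioo_of_le (tsum_nonneg fun k => (hd k).le)]
  refine (integrableOn_velocity hv hd hs z i j).mono_set_ae ?_
  have hc : ∀ᵐ t : ℝ, t ∉ range (breakPoint d) :=
    (countable_range (breakPoint d)).ae_notMem volume
  filter_upwards [hc] with t ht htm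
  exact mem_iUnion.2 (exists_mem_Ioo_breakPoint hs htm ht)

/-- The solution is defined by integrating the explicit `velocity`. Nilpotency of the generators
then shows that `J H M` is this velocity off the break points and the endpoint, a null set. -/
lemma exists_isMonodromyMatrix_stepHamiltonian (hv : ∀ n, v n 0 ^ 2 + v n 1 ^ 2 = 1)
    (hd : ∀ n, 0 < d n) (hs : Summable d) :
    ∃ M, IsMonodromyMatrix (stepHamiltonian v d) (∑' k, d k) M := by
  set L := ∑' k, d k with hL
  have hL0 : 0 ≤ L := tsum_nonneg fun k => (hd k).le
  set M : ℝ → ℂ → Matrix (Fin 2) (Fin 2) ℂ := fun x z => Matrix.of fun i j =>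
    (1 : Matrix (Fin 2) (Fin 2) ℂ) i j - z * ∫ t in (0 : ℝ)..x, velocity v d z t i j with hMdef
  have hM : ∀ x z i j, M x z i j =
    (1 : Matrix (Fin 2) (Fin 2) ℂ) i j - z * ∫ t in (0 : ℝ)..x, velocity v d z t i j :=
    fun _ _ _ _ => rfl
  have hmem : ∀ n, breakPoint d n ∈ Icc 0 L := fun n =>
    ⟨breakPoint_nonneg hd n, breakPoint_le_tsum hd hs n⟩
  have hInt : ∀ z, ∀ x ∈ Icc 0 L, ∀ y ∈ Icc 0 L, ∀ i j,
      IntervalIntegrable (fun t => velocity v d z t i j) volume x y := fun z x hx y hy i j =>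
    (intervalIntegrable_velocity hv hd hs z i j).mono_set (by
      rw [uIcc_of_le hL0]; exact uIcc_subset_Icc hx hy)
  have h0 : (0 : ℝ) ∈ Icc 0 L := ⟨le_rfl, hL0⟩
  have hpiece : ∀ z n, ∀ x ∈ Icc (breakPoint d n) (breakPoint d (n + 1)), M x z =
      M (breakPoint d n) z
        - (z * (x - breakPoint d n : ℝ)) • (generator v n * transfer v d z n) := by
    intro z n x hx
    ext i j
    have hxm : x ∈ Icc 0 L := ⟨(hmem n).1.trans hx.1, hx.2.trans (hmem (n + 1)).2⟩
    rw [Matrix.sub_apply, hM, hM, ← intervalIntegral.integral_add_adjacent_intervals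
      (hInt z 0 h0 _ (hmem n) i j) (hInt z _ (hmem n) x hxm i j)]
    rw [intervalIntegral.integral_congr_uIoo (a := breakPoint d n)
      (g := fun _ => (generator v n * transfer v d z n) i j)]
    · rw [intervalIntegral.integral_const, Matrix.smul_apply, Complex.real_smul, smul_eq_mul]
      ring
    · intro t ht
      rw [uIoo_of_le hx.1] at ht
      simp only [velocity_eq hd (n := n) ⟨ht.1, ht.2.trans_le hx.2⟩]
  have hbreak : ∀ z n, M (breakPoint d n) z = transfer v d z n := by
    intro z n
    induction n with
    | zero => ext i j; rw [hM, breakPoint_zero]; simp [transfer]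
    | succ n ih =>
      rw [hpiece z n _ (right_mem_Icc.2 (breakPoint_strictMono hd n.lt_succ_self).le), ih,
        breakPoint_succ, transfer, add_sub_cancel_left]
  have hvel : ∀ z, ∀ t ∈ Ioo 0 L, t ∉ range (breakPoint d) →
      J * (stepHamiltonian v d t).map Complex.ofReal * M t z = velocity v d z t := by
    intro z t ht hne
    obtain ⟨n, hn⟩ := exists_mem_Ioo_breakPoint hs ht hne
    rw [stepHamiltonian_eq hd hn, velocity_eq hd hn, hpiece z n t (Ioo_subset_Icc_self hn),
      hbreak]
    change generator v n * _ = _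
    rw [Matrix.mul_sub, Matrix.mul_smul, ← Matrix.mul_assoc, generator_mul_self, Matrix.zero_mul,
      smul_zero, sub_zero]
  have hae : ∀ᵐ t : ℝ, t ∉ range (breakPoint d) ∧ t ≠ L :=
    ((countable_range (breakPoint d)).ae_notMem volume).and
      ((countable_singleton L).ae_notMem volume)
  refine ⟨M, ⟨fun z => ?_, fun z i j => ?_, fun z x hx i j => ?_⟩⟩
  · refine continuousOn_pi.2 fun i => continuousOn_pi.2 fun j => ?_
    refine continuousOn_const.sub (continuousOn_const.mul ?_)
    rw [← uIcc_of_le hL0]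
    refine intervalIntegral.continuousOn_primitive_interval ?_
    rw [uIcc_of_le hL0]
    exact (intervalIntegrable_iff_integrableOn_Icc_of_le hL0).1 (hInt z 0 h0 L ⟨hL0, le_rfl⟩ i j)
  · refine (hInt z 0 h0 L ⟨hL0, le_rfl⟩ i j).congr_ae ?_
    refine (ae_restrict_iff' measurableSet_uIoc).2 ?_
    filter_upwards [hae] with t ht htm
    rw [uIoc_of_le hL0] at htm
    rw [hvel z t ⟨htm.1, lt_of_le_of_ne htm.2 ht.2⟩ ht.1]
  · rw [hM]
    congr 2
    refine intervalIntegral.integral_congr_ae ?_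
    filter_upwards [hae] with t ht htm
    rw [uIoc_of_le hx.1] at htm
    rw [hvel z t ⟨htm.1, lt_of_le_of_ne (htm.2.trans hx.2) ht.2⟩ ht.1]

/-! ### Growth of the transfer matrices in the moving frame. -/

/-- The sine of the angle between the directions of two successive pieces. -/
def turn (v : ℕ → Fin 2 → ℝ) (n : ℕ) : ℝ := v n 0 * v (n + 1) 1 - v n 1 * v (n + 1) 0

/-- A weighted norm of the `j`-th column of the transfer matrix in the orthonormal frame of the
`n`-th piece. -/
def frameNorm (v : ℕ → Fin 2 → ℝ) (d : ℕ → ℝ) (z : ℂ) (τ : ℝ) (j : Fin 2) (n : ℕ) : ℝ :=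
  ‖v n 0 * transfer v d z n 0 j + v n 1 * transfer v d z n 1 j‖ +
    τ * ‖v n 0 * transfer v d z n 1 j - v n 1 * transfer v d z n 0 j‖

lemma abs_apply_le_one (hv : ∀ n, v n 0 ^ 2 + v n 1 ^ 2 = 1) (n : ℕ) (i : Fin 2) :
    |v n i| ≤ 1 := by
  rw [← sq_le_one_iff_abs_le_one]
  fin_cases i
  · simp only [Fin.zero_eta]; nlinarith [hv n]
  · simp only [Fin.mk_one]; nlinarith [hv n]

lemma abs_turn_le_one (hv : ∀ n, v n 0 ^ 2 + v n 1 ^ 2 = 1) (n : ℕ) : |turn v n| ≤ 1 := by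
  rw [← sq_le_one_iff_abs_le_one]
  have : turn v n ^ 2 + (v n 0 * v (n + 1) 0 + v n 1 * v (n + 1) 1) ^ 2 = 1 := by
    rw [turn]
    linear_combination (v (n + 1) 0 ^ 2 + v (n + 1) 1 ^ 2) * hv n + hv (n + 1)
  nlinarith [sq_nonneg (v n 0 * v (n + 1) 0 + v n 1 * v (n + 1) 1)]

lemma frameNorm_nonneg (z : ℂ) {τ : ℝ} (hτ : 0 ≤ τ) (j : Fin 2) (n : ℕ) :
    0 ≤ frameNorm v d z τ j n :=
  add_nonneg (norm_nonneg _) (mul_nonneg hτ (norm_nonneg _))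

/-- The shear fixes `w` and changes `s` by a multiple of `w`, which the weight makes cheap; the
rotation can feed `s` into `w`, which the weight makes expensive. Hence `τ` multiplies one cost and
divides the other. -/
lemma frameNorm_succ_le (hv : ∀ n, v n 0 ^ 2 + v n 1 ^ 2 = 1) (hd : ∀ n, 0 < d n) (z : ℂ)
    {τ : ℝ} (hτ : 0 < τ) (hτ1 : τ ≤ 1) (j : Fin 2) (n : ℕ) :
    frameNorm v d z τ j (n + 1) ≤
      (1 + |turn v n| / τ) * (1 + τ * (‖z‖ * d n)) * frameNorm v d z τ j n := by
  set y0 := transfer v d z n 0 j with hy0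
  set y1 := transfer v d z n 1 j with hy1
  set w : ℂ := v n 0 * y0 + v n 1 * y1 with hw
  set s : ℂ := v n 0 * y1 - v n 1 * y0 with hs
  set κ : ℝ := v n 0 * v (n + 1) 0 + v n 1 * v (n + 1) 1 with hκ
  set σ : ℝ := turn v n with hσ
  have hσ' : σ = v n 0 * v (n + 1) 1 - v n 1 * v (n + 1) 0 := rfl
  have hY0 : transfer v d z (n + 1) 0 j = y0 + z * d n * (v n 1 * w) := by
    simp only [transfer, Matrix.sub_apply, Matrix.smul_apply, smul_eq_mul,
      generator_mul_apply_zero, hw, hy0, hy1]; ring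
  have hY1 : transfer v d z (n + 1) 1 j = y1 - z * d n * (v n 0 * w) := by
    simp only [transfer, Matrix.sub_apply, Matrix.smul_apply, smul_eq_mul,
      generator_mul_apply_one, hw, hy0, hy1]
  have hvC : (v n 0 : ℂ) ^ 2 + (v n 1 : ℂ) ^ 2 = 1 := by exact_mod_cast hv n
  set s' : ℂ := s - z * d n * w with hs'
  -- The next direction in the frame formed by `v n` and its rotation by a right angle, with cosine
  -- `κ` and sine `σ`.
  have e0 : v (n + 1) 0 = κ * v n 0 - σ * v n 1 := by
    rw [hσ', hκ]; linear_combination (-v (n + 1) 0) * hv n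
  have e1 : v (n + 1) 1 = κ * v n 1 + σ * v n 0 := by
    rw [hσ', hκ]; linear_combination (-v (n + 1) 1) * hv n
  have hw' : (v (n + 1) 0 : ℂ) * transfer v d z (n + 1) 0 j
      + v (n + 1) 1 * transfer v d z (n + 1) 1 j = κ * w + σ * s' := by
    rw [hY0, hY1, e0, e1, hs']
    push_cast
    rw [hs, hw]
    linear_combination (-(σ : ℂ) * z * d n * (v n 0 * y0 + v n 1 * y1)) * hvC
  have hs'' : (v (n + 1) 0 : ℂ) * transfer v d z (n + 1) 1 j
      - v (n + 1) 1 * transfer v d z (n + 1) 0 j = κ * s' - σ * w := by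
    rw [hY0, hY1, e0, e1, hs']
    push_cast
    rw [hs, hw]
    linear_combination (-(κ : ℂ) * z * d n * (v n 0 * y0 + v n 1 * y1)) * hvC
  have hκ1 : |κ| ≤ 1 := by
    rw [← sq_le_one_iff_abs_le_one]
    have : σ ^ 2 + κ ^ 2 = 1 := by
      rw [hσ', hκ]; linear_combination (v (n + 1) 0 ^ 2 + v (n + 1) 1 ^ 2) * hv n + hv (n + 1)
    nlinarith [sq_nonneg σ]
  have hσ0 := abs_nonneg σ
  have b1 : ‖(κ : ℂ) * w + σ * s'‖ ≤ ‖w‖ + |σ| * ‖s'‖ := by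
    refine (norm_add_le _ _).trans (add_le_add ?_ ?_)
    · rw [norm_mul, Complex.norm_real, Real.norm_eq_abs]
      exact mul_le_of_le_one_left (norm_nonneg _) hκ1
    · rw [norm_mul, Complex.norm_real, Real.norm_eq_abs]
  have b2 : ‖(κ : ℂ) * s' - σ * w‖ ≤ ‖s'‖ + |σ| * ‖w‖ := by
    refine (norm_sub_le _ _).trans (add_le_add ?_ ?_)
    · rw [norm_mul, Complex.norm_real, Real.norm_eq_abs]
      exact mul_le_of_le_one_left (norm_nonneg _) hκ1
    · rw [norm_mul, Complex.norm_real, Real.norm_eq_abs]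
  have b3 : ‖s'‖ ≤ ‖s‖ + ‖z‖ * d n * ‖w‖ := by
    refine (norm_sub_le _ _).trans (add_le_add le_rfl ?_)
    rw [norm_mul, norm_mul, Complex.norm_real, Real.norm_of_nonneg (hd n).le]
  have hR : 0 ≤ ‖z‖ * d n := mul_nonneg (norm_nonneg _) (hd n).le
  have hdiv : |σ| ≤ |σ| / τ := by rw [le_div_iff₀ hτ]; nlinarith
  have hW := norm_nonneg w
  have hS := norm_nonneg s
  have hS' := norm_nonneg s'
  have hστ : |σ| / τ * τ = |σ| := div_mul_cancel₀ _ hτ.ne'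
  have hq : 0 ≤ |σ| / τ := by positivity
  have step1 : frameNorm v d z τ j (n + 1) ≤ (1 + |σ| / τ) * (‖w‖ + τ * ‖s'‖) := by
    rw [frameNorm, hw', hs'']
    calc _ ≤ (‖w‖ + |σ| * ‖s'‖) + τ * (‖s'‖ + |σ| * ‖w‖) :=
          add_le_add b1 (mul_le_mul_of_nonneg_left b2 hτ.le)
      _ = ‖w‖ + |σ| / τ * τ * ‖s'‖ + τ * ‖s'‖ + τ * |σ| * ‖w‖ := by rw [hστ]; ring
      _ ≤ ‖w‖ + |σ| / τ * τ * ‖s'‖ + τ * ‖s'‖ + |σ| / τ * ‖w‖ := by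
          have : τ * |σ| ≤ |σ| / τ := (mul_le_of_le_one_left hσ0 hτ1).trans hdiv
          have := mul_le_mul_of_nonneg_right this hW
          linarith
      _ = _ := by ring
  refine step1.trans ?_
  rw [mul_assoc]
  refine mul_le_mul_of_nonneg_left ?_ (by positivity)
  rw [frameNorm, ← hy0, ← hy1, ← hw, ← hs]
  calc ‖w‖ + τ * ‖s'‖ ≤ ‖w‖ + τ * (‖s‖ + ‖z‖ * d n * ‖w‖) := by gcongr
    _ ≤ (1 + τ * (‖z‖ * d n)) * (‖w‖ + τ * ‖s‖) := by
      have : 0 ≤ τ * (‖z‖ * d n) * (τ * ‖s‖) := by positivity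
      nlinarith

lemma frameNorm_zero_le (hv : ∀ n, v n 0 ^ 2 + v n 1 ^ 2 = 1) (z : ℂ)
    {τ : ℝ} (hτ : 0 < τ) (hτ1 : τ ≤ 1) (j : Fin 2) : frameNorm v d z τ j 0 ≤ 2 := by
  have h0 := abs_apply_le_one hv 0 0
  have h1 := abs_apply_le_one hv 0 1
  have a0 := abs_nonneg (v 0 0)
  have a1 := abs_nonneg (v 0 1)
  fin_cases j <;> simp [frameNorm, transfer, Matrix.one_apply] <;> nlinarith

/-- The entries are recovered from the frame coordinates `w`, `s` with coefficients at most `1`;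
undoing the weight costs `1 / τ`. -/
lemma norm_transfer_apply_le (hv : ∀ n, v n 0 ^ 2 + v n 1 ^ 2 = 1) (z : ℂ)
    {τ : ℝ} (hτ : 0 < τ) (hτ1 : τ ≤ 1) (i j : Fin 2) (n : ℕ) :
    ‖transfer v d z n i j‖ ≤ frameNorm v d z τ j n / τ := by
  set y0 := transfer v d z n 0 j with hy0
  set y1 := transfer v d z n 1 j with hy1
  set w : ℂ := v n 0 * y0 + v n 1 * y1 with hw
  set s : ℂ := v n 0 * y1 - v n 1 * y0 with hs
  have hvC : (v n 0 : ℂ) ^ 2 + (v n 1 : ℂ) ^ 2 = 1 := by exact_mod_cast hv n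
  have e0 : y0 = v n 0 * w - v n 1 * s := by rw [hw, hs]; linear_combination (-y0) * hvC
  have e1 : y1 = v n 1 * w + v n 0 * s := by rw [hw, hs]; linear_combination (-y1) * hvC
  have hb : ∀ i, ∀ y : ℂ, ‖(v n i : ℂ) * y‖ ≤ ‖y‖ := fun i y => by
    rw [norm_mul, Complex.norm_real, Real.norm_eq_abs]
    exact mul_le_of_le_one_left (norm_nonneg _) (abs_apply_le_one hv n i)
  have hsum : ‖w‖ + ‖s‖ ≤ frameNorm v d z τ j n / τ := by
    rw [le_div_iff₀ hτ, frameNorm, ← hy0, ← hy1, ← hw, ← hs]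
    nlinarith [norm_nonneg w]
  refine le_trans ?_ hsum
  fin_cases i
  · change ‖y0‖ ≤ _
    rw [e0]
    exact (norm_sub_le _ _).trans (add_le_add (hb _ _) (hb _ _))
  · change ‖y1‖ ≤ _
    rw [e1]
    exact (norm_add_le _ _).trans (add_le_add (hb _ _) (hb _ _))

/-- The growth of the transfer matrices: crude bounds on the first `N` pieces, and the cost of
rotating and stretching a frame of fixed eccentricity on the other ones. -/
lemma norm_transfer_add_le (hv : ∀ n, v n 0 ^ 2 + v n 1 ^ 2 = 1) (hd : ∀ n, 0 < d n) (z : ℂ)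
    {τ B : ℝ} (hτ : 0 < τ) (hτ1 : τ ≤ 1) (hB : ∀ n, d n ≤ B) (i j : Fin 2) (N m : ℕ) :
    ‖transfer v d z (N + m) i j‖ ≤ 2 / τ * ((1 + 1 / τ) * (1 + ‖z‖ * B)) ^ N *
      Real.exp (∑ k ∈ Finset.range m, (|turn v (N + k)| / τ + τ * (‖z‖ * d (N + k)))) := by
  have hB0 : 0 ≤ B := (hd 0).le.trans (hB 0)
  have head : ∀ N, frameNorm v d z τ j N ≤ 2 * ((1 + 1 / τ) * (1 + ‖z‖ * B)) ^ N := by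
    intro N
    induction N with
    | zero => simpa using frameNorm_zero_le hv z hτ hτ1 j
    | succ N ih =>
      refine (frameNorm_succ_le hv hd z hτ hτ1 j N).trans ?_
      have h1 : |turn v N| / τ ≤ 1 / τ := by
        gcongr; exact abs_turn_le_one hv N
      have h2 : τ * (‖z‖ * d N) ≤ ‖z‖ * B := by
        refine (mul_le_of_le_one_left (mul_nonneg (norm_nonneg _) (hd N).le) hτ1).trans ?_
        gcongr; exact hB N
      have h3 : 0 ≤ τ * (‖z‖ * d N) := mul_nonneg hτ.le (mul_nonneg (norm_nonneg _) (hd N).le)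
      calc _ ≤ (1 + 1 / τ) * (1 + ‖z‖ * B) * (2 * ((1 + 1 / τ) * (1 + ‖z‖ * B)) ^ N) := by
            refine mul_le_mul ?_ ih (frameNorm_nonneg z hτ.le j N) (by positivity)
            exact mul_le_mul (by linarith) (by linarith) (by linarith) (by positivity)
        _ = _ := by ring
  have tail : frameNorm v d z τ j (N + m) ≤ 2 * ((1 + 1 / τ) * (1 + ‖z‖ * B)) ^ N *
      Real.exp (∑ k ∈ Finset.range m, (|turn v (N + k)| / τ + τ * (‖z‖ * d (N + k)))) := by
    induction m with
    | zero => simpa using head N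
    | succ m ih =>
      refine (frameNorm_succ_le hv hd z hτ hτ1 j (N + m)).trans ?_
      have h1 : 0 ≤ |turn v (N + m)| / τ := by positivity
      have h3 : 0 ≤ τ * (‖z‖ * d (N + m)) :=
        mul_nonneg hτ.le (mul_nonneg (norm_nonneg _) (hd _).le)
      rw [Finset.sum_range_succ, Real.exp_add, Real.exp_add]
      have h4 := mul_le_mul (mul_le_mul (Real.add_one_le_exp (|turn v (N + m)| / τ))
        (Real.add_one_le_exp (τ * (‖z‖ * d (N + m)))) (by linarith) (Real.exp_nonneg _)) ih
        (frameNorm_nonneg z hτ.le j _) (by positivity)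
      rw [add_comm 1, add_comm 1]
      exact h4.trans (le_of_eq (by ring))
  refine (norm_transfer_apply_le hv z hτ hτ1 i j (N + m)).trans ?_
  rw [div_le_iff₀ hτ]
  refine tail.trans (le_of_eq ?_)
  field_simp

end CanonicalSystem

/-! ### Tails of power sums, and order from an exponential bound. -/

lemma sum_range_add_rpow_le {s : ℝ} (hs : 1 < s) {N : ℕ} (hN : 1 ≤ N) (m : ℕ) :
    ∑ k ∈ Finset.range m, ((N + k : ℕ) + 1 : ℝ) ^ (-s) ≤ (N : ℝ) ^ (1 - s) / (s - 1) := by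
  have hN0 : (0 : ℝ) < N := by exact_mod_cast hN
  have hanti : AntitoneOn (fun x : ℝ => x ^ (-s)) (Icc (N : ℝ) (N + m)) := fun x hx y _ hxy =>
    Real.rpow_le_rpow_of_nonpos (hN0.trans_le hx.1) hxy (by linarith)
  have h := hanti.sum_le_integral
  have h0 : (0 : ℝ) ∉ uIcc (N : ℝ) (N + m) := by
    rw [uIcc_of_le (by simp)]; exact fun h => absurd h.1 (not_le.2 hN0)
  rw [integral_rpow (Or.inr ⟨by linarith, h0⟩)] at h
  -- The terms sit at the right endpoints `N + k + 1` of unit intervals starting at `N`, so the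
  -- integral dominates without a boundary term.
  calc _ = ∑ k ∈ Finset.range m, ((N : ℝ) + ((k + 1 : ℕ) : ℝ)) ^ (-s) := by
        refine Finset.sum_congr rfl fun k _ => ?_
        push_cast; ring_nf
    _ ≤ _ := h
    _ = ((N : ℝ) ^ (1 - s) - ((N : ℝ) + m) ^ (1 - s)) / (s - 1) := by
        rw [show -s + 1 = 1 - s by ring, show (1 - s) = -(s - 1) by ring, div_neg, ← neg_div]
        ring_nf
    _ ≤ _ := by
        have : 0 ≤ ((N : ℝ) + m) ^ (1 - s) := by positivity
        have : 0 < s - 1 := by linarith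
        gcongr
        linarith

/-- A bound `exp (K |z| ^ s log |z|)` on an entire function gives order at most `s`. -/
lemma growthOrder_le_of_norm_le_exp {f : ℂ → ℂ} {K s : ℝ} (hs : 0 ≤ s)
    (h : ∀ᶠ z in Bornology.cobounded ℂ, ‖f z‖ ≤ Real.exp (K * ‖z‖ ^ s * Real.log ‖z‖)) :
    growthOrder f ≤ (s : EReal) := by
  have hlog : Tendsto (fun z : ℂ => Real.log ‖z‖) (Bornology.cobounded ℂ) atTop :=
    Real.tendsto_log_atTop.comp tendsto_norm_cobounded_atTop
  -- Enlarging `K` to at least `1` makes `X ≥ 1` below, so positive parts of logarithms become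
  -- logarithms.
  set K' := max K 1 with hK'
  have hK1 : 1 ≤ K' := le_max_right _ _
  set g : ℂ → ℝ := fun z => s + (Real.log K' / Real.log ‖z‖ +
    Real.log (Real.log ‖z‖) / Real.log ‖z‖) with hg
  have hgt : Tendsto g (Bornology.cobounded ℂ) (nhds s) := by
    have h1 : Tendsto (fun z : ℂ => Real.log K' / Real.log ‖z‖) (Bornology.cobounded ℂ) (nhds 0) :=
      hlog.const_div_atTop _
    have h2 : Tendsto (fun z : ℂ => Real.log (Real.log ‖z‖) / Real.log ‖z‖)
        (Bornology.cobounded ℂ) (nhds 0) :=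
      (Real.isLittleO_log_id_atTop.tendsto_div_nhds_zero).comp hlog
    simpa using tendsto_const_nhds.add (h1.add h2)
  have hgt' : Tendsto (fun z => (g z : EReal)) (Bornology.cobounded ℂ) (nhds (s : EReal)) :=
    (continuous_coe_real_ereal.tendsto s).comp hgt
  rw [← hgt'.limsup_eq]
  refine limsup_le_limsup ?_
  filter_upwards [h, hlog.eventually_ge_atTop 1,
    tendsto_norm_cobounded_atTop.eventually_ge_atTop 1] with z hz hl hz1
  refine EReal.coe_le_coe_iff.2 ?_
  have hz0 : 0 < ‖z‖ := by linarith
  have hl0 : 0 < Real.log ‖z‖ := by linarith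
  have hp : 0 < ‖z‖ ^ s := Real.rpow_pos_of_pos hz0 s
  have hp1 : 1 ≤ ‖z‖ ^ s := Real.one_le_rpow hz1 hs
  set X := K' * ‖z‖ ^ s * Real.log ‖z‖ with hXdef
  have hX1 : 1 ≤ X := one_le_mul_of_one_le_of_one_le (one_le_mul_of_one_le_of_one_le hK1 hp1) hl
  have hlogX : Real.log X = g z * Real.log ‖z‖ := by
    rw [hXdef, Real.log_mul (by positivity) hl0.ne', Real.log_mul (by positivity) hp.ne',
      Real.log_rpow hz0, hg]
    field_simp
    ring
  have hfX : ‖f z‖ ≤ Real.exp X := by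
    refine hz.trans (Real.exp_le_exp.2 ?_)
    exact mul_le_mul_of_nonneg_right
      (mul_le_mul_of_nonneg_right (le_max_left _ _) hp.le) hl0.le
  have h1 : log⁺ ‖f z‖ ≤ X := by
    refine (Real.posLog_le_posLog (norm_nonneg _) hfX).trans (le_of_eq ?_)
    rw [Real.posLog_eq_log (by rw [abs_of_pos (Real.exp_pos _)]; exact Real.one_le_exp (by linarith)),
      Real.log_exp]
  have h2 : log⁺ (log⁺ ‖f z‖) ≤ Real.log X := by
    refine (Real.posLog_le_posLog Real.posLog_nonneg h1).trans (le_of_eq ?_)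
    rw [Real.posLog_eq_log (by rwa [abs_of_pos (by linarith)])]
  rw [div_le_iff₀ hl0, ← hlogX]
  exact h2

/-! ### The order under power decay of lengths and angles. -/

namespace CanonicalSystem

lemma norm_transfer_add_ceil_le {v : ℕ → Fin 2 → ℝ} {d : ℕ → ℝ}
    (hv : ∀ n, v n 0 ^ 2 + v n 1 ^ 2 = 1) (hd : ∀ n, 0 < d n)
    {Δ D K : ℝ} (hΔ : 1 < Δ) (hΔD : Δ < D - 1) (hK : 0 < K)
    (hturn : ∀ n, |turn v n| ≤ K * ((n : ℝ) + 1) ^ (-Δ))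
    (hlen : ∀ n, d n ≤ K * ((n : ℝ) + 1) ^ (-(D - Δ))) {z : ℂ} {N : ℕ} (hN : 1 ≤ N)
    (hz : ‖z‖ ≤ (N : ℝ) ^ D) (i j : Fin 2) (m : ℕ) :
    ‖transfer v d z (N + m) i j‖ ≤ Real.exp (N * (Real.log 2 + Real.log (2 * (1 + K)) +
      K / (Δ - 1) + K / (D - Δ - 1) + (2 * Δ + D) * Real.log N)) := by
  have hN1 : (1 : ℝ) ≤ N := by exact_mod_cast hN
  have hN0 : (0 : ℝ) < N := by linarith
  have hlogN : 0 ≤ Real.log N := Real.log_nonneg hN1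
  have hB : ∀ n, d n ≤ K := fun n => (hlen n).trans (mul_le_of_le_one_right hK.le
    (Real.rpow_le_one_of_one_le_of_nonpos (by linarith [(Nat.cast_nonneg n : (0 : ℝ) ≤ n)])
      (by linarith)))
  -- This weight balances the two tails `N ^ (1 - Δ) / τ` and `τ N ^ D N ^ (1 - (D - Δ))`: both
  -- equal `N`.
  set τ : ℝ := (N : ℝ) ^ (-Δ) with hτ
  have hτ0 : 0 < τ := Real.rpow_pos_of_pos hN0 _
  have hτ1 : τ ≤ 1 := Real.rpow_le_one_of_one_le_of_nonpos hN1 (by linarith)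
  have hτi : 1 / τ = Real.exp (Δ * Real.log N) := by
    rw [hτ, Real.rpow_neg hN0.le, one_div, inv_inv, Real.rpow_def_of_pos hN0, mul_comm]
  have hND : (N : ℝ) ^ D = Real.exp (D * Real.log N) := by
    rw [Real.rpow_def_of_pos hN0, mul_comm]
  have hsum : ∑ k ∈ Finset.range m, (|turn v (N + k)| / τ + τ * (‖z‖ * d (N + k))) ≤
      N * (K / (Δ - 1) + K / (D - Δ - 1)) := by
    rw [Finset.sum_add_distrib, mul_add]
    refine add_le_add ?_ ?_
    · calc _ ≤ ∑ k ∈ Finset.range m, K * ((N + k : ℕ) + 1 : ℝ) ^ (-Δ) / τ := by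
            gcongr with k; exact hturn _
        _ = K / τ * ∑ k ∈ Finset.range m, ((N + k : ℕ) + 1 : ℝ) ^ (-Δ) := by
            rw [Finset.mul_sum]; exact Finset.sum_congr rfl fun k _ => by ring
        _ ≤ K / τ * ((N : ℝ) ^ (1 - Δ) / (Δ - 1)) := by
            gcongr; exact sum_range_add_rpow_le hΔ hN m
        _ = N * (K / (Δ - 1)) := by
            have : (N : ℝ) ^ (1 - Δ) = N * τ := by
              rw [hτ, sub_eq_add_neg, Real.rpow_add hN0, Real.rpow_one]
            rw [this]; field_simp
    · calc _ ≤ ∑ k ∈ Finset.range m,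
              τ * ((N : ℝ) ^ D * (K * ((N + k : ℕ) + 1 : ℝ) ^ (-(D - Δ)))) := by
            gcongr with k
            · exact (hd _).le
            · exact hlen _
        _ = τ * N ^ D * K * ∑ k ∈ Finset.range m, ((N + k : ℕ) + 1 : ℝ) ^ (-(D - Δ)) := by
            rw [Finset.mul_sum]; exact Finset.sum_congr rfl fun k _ => by ring
        _ ≤ τ * N ^ D * K * ((N : ℝ) ^ (1 - (D - Δ)) / (D - Δ - 1)) := by
            gcongr; exact sum_range_add_rpow_le (by linarith) hN m
        _ = N * (K / (D - Δ - 1)) := by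
            have : τ * N ^ D * (N : ℝ) ^ (1 - (D - Δ)) = N := by
              rw [hτ, ← Real.rpow_add hN0, ← Real.rpow_add hN0]
              ring_nf
              exact Real.rpow_one _
            linear_combination (K / (D - Δ - 1)) * this
  refine (norm_transfer_add_le hv hd z hτ0 hτ1 hB i j N m).trans ?_
  have hE1 : 1 + 1 / τ ≤ 2 * Real.exp (Δ * Real.log N) := by
    rw [hτi]
    have : 1 ≤ Real.exp (Δ * Real.log N) := Real.one_le_exp (by positivity)
    linarith
  have hE2 : 1 + ‖z‖ * K ≤ (1 + K) * Real.exp (D * Real.log N) := by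
    rw [← hND]
    have : 1 ≤ (N : ℝ) ^ D := Real.one_le_rpow hN1 (by linarith)
    have := mul_le_mul_of_nonneg_right hz hK.le
    nlinarith
  have hE3 : 2 / τ = Real.exp (Real.log 2 + Δ * Real.log N) := by
    rw [Real.exp_add, Real.exp_log two_pos, ← hτi]; ring
  have hE4 : (1 + 1 / τ) * (1 + ‖z‖ * K) ≤
      Real.exp (Real.log (2 * (1 + K)) + (Δ + D) * Real.log N) := by
    rw [Real.exp_add, Real.exp_log (by positivity), add_mul Δ D, Real.exp_add]
    calc _ ≤ (2 * Real.exp (Δ * Real.log N)) * ((1 + K) * Real.exp (D * Real.log N)) :=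
          mul_le_mul hE1 hE2 (by positivity) (by positivity)
      _ = _ := by ring
  calc _ ≤ Real.exp (Real.log 2 + Δ * Real.log N) *
        Real.exp (Real.log (2 * (1 + K)) + (Δ + D) * Real.log N) ^ N *
        Real.exp (N * (K / (Δ - 1) + K / (D - Δ - 1))) := by
        rw [hE3]; gcongr
    _ ≤ _ := by
        rw [← Real.exp_nat_mul, ← Real.exp_add, ← Real.exp_add]
        refine Real.exp_le_exp.2 ?_
        -- The single prefactor `2 / τ` is absorbed by counting it `N` times.
        have : Real.log 2 + Δ * Real.log N ≤ N * (Real.log 2 + Δ * Real.log N) :=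
          le_mul_of_one_le_left (add_nonneg (Real.log_nonneg one_le_two) (by positivity)) hN1
        linarith

/-- The order of a canonical system whose step Hamiltonian has power decay of the lengths of its
pieces and of the angles between them. -/
lemma IsMonodromyMatrix.growthOrder_le {v : ℕ → Fin 2 → ℝ} {d : ℕ → ℝ}
    (hv : ∀ n, v n 0 ^ 2 + v n 1 ^ 2 = 1) (hd : ∀ n, 0 < d n) (hs : Summable d)
    {Δ D K : ℝ} (hΔ : 1 < Δ) (hΔD : Δ < D - 1) (hK : 0 < K)
    (hturn : ∀ n, |turn v n| ≤ K * ((n : ℝ) + 1) ^ (-Δ))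
    (hlen : ∀ n, d n ≤ K * ((n : ℝ) + 1) ^ (-(D - Δ)))
    {M : ℝ → ℂ → Matrix (Fin 2) (Fin 2) ℂ}
    (hM : IsMonodromyMatrix (stepHamiltonian v d) (∑' k, d k) M) (i j : Fin 2) :
    growthOrder (fun z => M (∑' k, d k) z i j) ≤ ((1 / D : ℝ) : EReal) := by
  have hD : 0 < D := by linarith
  set a := Real.log 2 + Real.log (2 * (1 + K)) + K / (Δ - 1) + K / (D - Δ - 1) with ha
  have ha0 : 0 ≤ a := by
    have h1 : 0 ≤ Real.log 2 := Real.log_nonneg one_le_two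
    have h2 : 0 ≤ Real.log (2 * (1 + K)) := Real.log_nonneg (by linarith)
    have h3 : 0 < Δ - 1 := by linarith
    have h4 : 0 < D - Δ - 1 := by linarith
    positivity
  -- The outer `2` comes from `N ≤ 2 r`, the inner one from `log N ≤ 2 log |z|`.
  refine growthOrder_le_of_norm_le_exp (K := 2 * (a + 2 * (2 * Δ + D))) (by positivity) ?_
  have hlog : Tendsto (fun z : ℂ => Real.log ‖z‖) (Bornology.cobounded ℂ) atTop :=
    Real.tendsto_log_atTop.comp tendsto_norm_cobounded_atTop
  filter_upwards [hlog.eventually_ge_atTop 1,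
    tendsto_norm_cobounded_atTop.eventually_ge_atTop 1] with z hl hz1
  have hz0 : 0 < ‖z‖ := by linarith
  set r := ‖z‖ ^ (1 / D) with hr
  have hr1 : 1 ≤ r := Real.one_le_rpow hz1 (by positivity)
  set N := ⌈r⌉₊ with hN
  have hrN : r ≤ N := Nat.le_ceil r
  have hN2 : (N : ℝ) ≤ 2 * r := by linarith [Nat.ceil_lt_add_one (zero_le_one.trans hr1)]
  have hN1 : 1 ≤ N := Nat.one_le_ceil_iff.2 (by linarith)
  have hN1' : (1 : ℝ) ≤ N := by exact_mod_cast hN1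
  have hzN : ‖z‖ ≤ (N : ℝ) ^ D := by
    calc ‖z‖ = r ^ D := by rw [hr, ← Real.rpow_mul hz0.le, one_div_mul_cancel hD.ne', Real.rpow_one]
      _ ≤ _ := by gcongr
  have hlogN : Real.log N ≤ 2 * Real.log ‖z‖ := by
    calc Real.log N ≤ Real.log (2 * r) := Real.log_le_log (by linarith) hN2
      _ = Real.log 2 + 1 / D * Real.log ‖z‖ := by
        rw [Real.log_mul two_ne_zero (by linarith), hr, Real.log_rpow hz0]
      _ ≤ Real.log ‖z‖ + 1 * Real.log ‖z‖ := by
        refine add_le_add ?_ (mul_le_mul_of_nonneg_right ?_ (by linarith))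
        · exact (by linarith [Real.log_two_lt_d9] : Real.log 2 ≤ 1).trans hl
        · rw [div_le_one hD]; linarith
      _ = _ := by ring
  -- The bound does not depend on `m`, so it passes to the endpoint by continuity of `M`.
  have hbound : ∀ m, ‖M (breakPoint d (m + N)) z i j‖ ≤
      Real.exp (2 * (a + 2 * (2 * Δ + D)) * r * Real.log ‖z‖) := by
    intro m
    rw [hM.apply_breakPoint hd hs, add_comm m N]
    refine (norm_transfer_add_ceil_le hv hd hΔ hΔD hK hturn hlen hN1 hzN i j m).trans
      (Real.exp_le_exp.2 ?_)
    rw [← ha]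
    calc (N : ℝ) * (a + (2 * Δ + D) * Real.log N)
        ≤ 2 * r * (a * Real.log ‖z‖ + (2 * Δ + D) * (2 * Real.log ‖z‖)) := by
          have hlN : 0 ≤ Real.log N := Real.log_nonneg hN1'
          gcongr
          exact le_mul_of_one_le_right ha0 hl
      _ = _ := by ring
  have hcont : Tendsto (fun m => M (breakPoint d (m + N)) z) atTop
      (nhds (M (∑' k, d k) z)) := by
    have hL : ∑' k, d k ∈ Icc 0 (∑' k, d k) := ⟨tsum_nonneg fun k => (hd k).le, le_rfl⟩
    refine (hM.continuousOn z _ hL).tendsto.comp (tendsto_nhdsWithin_iff.2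
      ⟨(tendsto_add_atTop_iff_nat N).2 (tendsto_breakPoint hs), Eventually.of_forall fun m =>
        ⟨breakPoint_nonneg hd _, breakPoint_le_tsum hd hs _⟩⟩)
  have hij : Tendsto (fun m => M (breakPoint d (m + N)) z i j) atTop
      (nhds (M (∑' k, d k) z i j)) :=
    tendsto_pi_nhds.1 (tendsto_pi_nhds.1 hcont i) j
  exact le_of_tendsto hij.norm (Eventually.of_forall hbound)

end CanonicalSystem

/-! ### Lengths and angles for a Jacobi matrix. -/

namespace JacobiMatrix

open CanonicalSystem

/-- The recurrence preserves the weighted Wronskian, and the initial values make it `1`. It gives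
both the positivity of `δ` and the angles. -/
lemma wronskian (A : JacobiMatrix) (x : ℝ) (n : ℕ) :
    A.ρ (n + 1) * ((A.P (n + 1)).eval x * (A.Q (n + 2)).eval x
      - (A.P (n + 2)).eval x * (A.Q (n + 1)).eval x) = 1 := by
  induction n with
  | zero =>
    have := (A.ρ_pos 1 le_rfl).ne'
    simp [P, Q, this]
  | succ n ih =>
    have h := (A.ρ_pos (n + 2) (by omega)).ne'
    rw [show n + 1 + 2 = n + 3 from rfl, show n + 1 + 1 = n + 2 from rfl]
    rw [P.eq_def A (n + 3), Q.eq_def A (n + 3)]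
    simp only [Polynomial.eval_mul, Polynomial.eval_sub, Polynomial.eval_C, Polynomial.eval_X]
    rw [← ih]
    field_simp
    ring

lemma δ_pos (A : JacobiMatrix) (n : ℕ) : 0 < A.δ (n + 1) := by
  refine lt_of_le_of_ne (by unfold δ; positivity) fun h => ?_
  have hP : (A.P (n + 1)).eval 0 = 0 := by
    unfold δ at h; nlinarith [sq_nonneg ((A.P (n + 1)).eval 0), sq_nonneg ((A.Q (n + 1)).eval 0)]
  have hQ : (A.Q (n + 1)).eval 0 = 0 := by
    unfold δ at h; nlinarith [sq_nonneg ((A.P (n + 1)).eval 0), sq_nonneg ((A.Q (n + 1)).eval 0)]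
  have := A.wronskian 0 n
  rw [hP, hQ] at this
  simp at this

lemma e_sq_add_sq (A : JacobiMatrix) (n : ℕ) : A.e (n + 1) 0 ^ 2 + A.e (n + 1) 1 ^ 2 = 1 := by
  have h := A.δ_pos n
  simp only [e, cons_val_zero, cons_val_one, div_pow, Real.sq_sqrt h.le, neg_sq]
  rw [← add_div]
  exact div_self h.ne'

lemma turn_e (A : JacobiMatrix) (n : ℕ) : turn (fun n => A.e (n + 1)) n =
    -(A.ρ (n + 1) * (√(A.δ (n + 1)) * √(A.δ (n + 2))))⁻¹ := by
  have h0 := (Real.sqrt_pos.2 (A.δ_pos n)).ne'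
  have h1 := (Real.sqrt_pos.2 (A.δ_pos (n + 1))).ne'
  have h2 := (A.ρ_pos (n + 1) (by omega)).ne'
  have hw := A.wronskian 0 n
  simp only [turn, e, cons_val_zero, cons_val_one, show n + 1 + 1 = n + 2 from rfl] at h1 ⊢
  field_simp
  linear_combination -hw

lemma hamiltonian_eq (A : JacobiMatrix) :
    A.hamiltonian = stepHamiltonian (fun n => A.e (n + 1)) (fun n => A.δ (n + 1)) := rfl

/-- The angles between successive vectors `e n` decay like `n ^ (-Δ)`. -/
lemma turn_e_isBigO (A : JacobiMatrix) {Δ D C c : ℝ} (hC : 0 < C) (hc : 0 < c)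
    (hΔD : Δ - D ≤ 0)
    (hPQ : A.δ ~[atTop] (fun n : ℕ => C * (n : ℝ) ^ (Δ - D)))
    (hρ : A.ρ ~[atTop] (fun n : ℕ => c * (n : ℝ) ^ D)) :
    turn (fun n => A.e (n + 1)) =O[atTop] (fun n : ℕ => ((n : ℝ) + 1) ^ (-Δ)) := by
  have hshift : Tendsto (fun n : ℕ => n + 1) atTop atTop := tendsto_add_atTop_nat 1
  have hshift2 : Tendsto (fun n : ℕ => n + 2) atTop atTop := tendsto_add_atTop_nat 2
  have hδO : (fun n : ℕ => (n : ℝ) ^ (Δ - D)) =O[atTop] A.δ :=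
    (isBigO_const_mul_self C⁻¹ (fun n : ℕ => C * (n : ℝ) ^ (Δ - D)) atTop |>.congr_left
      fun n => by field_simp).trans hPQ.isBigO_symm
  have hρO : (fun n : ℕ => (n : ℝ) ^ D) =O[atTop] A.ρ :=
    (isBigO_const_mul_self c⁻¹ (fun n : ℕ => c * (n : ℝ) ^ D) atTop |>.congr_left
      fun n => by field_simp).trans hρ.isBigO_symm
  -- The sine involves two successive `δ`. Since `n + 1 ≥ (n + 2) / 2` and the exponent is
  -- nonpositive, the shift costs a constant.
  have hcmp : (fun n : ℕ => ((n : ℝ) + 1) ^ (Δ - D)) =O[atTop]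
      (fun n : ℕ => ((n : ℝ) + 2) ^ (Δ - D)) := by
    refine IsBigO.of_bound (2⁻¹ ^ (Δ - D)) (Eventually.of_forall fun n => ?_)
    rw [Real.norm_of_nonneg (by positivity), Real.norm_of_nonneg (by positivity),
      ← Real.mul_rpow (by positivity) (by positivity)]
    exact Real.rpow_le_rpow_of_nonpos (by positivity)
      (by linarith [(Nat.cast_nonneg n : (0 : ℝ) ≤ n)]) hΔD
  have h1 : (fun n : ℕ => ((n : ℝ) + 1) ^ (Δ - D)) =O[atTop] (fun n => A.δ (n + 1)) := by
    simpa [Function.comp_def] using hδO.comp_tendsto hshift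
  have h2 : (fun n : ℕ => ((n : ℝ) + 1) ^ (Δ - D)) =O[atTop] (fun n => A.δ (n + 2)) :=
    hcmp.trans (by simpa [Function.comp_def] using hδO.comp_tendsto hshift2)
  have h3 : (fun n : ℕ => ((n : ℝ) + 1) ^ D) =O[atTop] (fun n => A.ρ (n + 1)) := by
    simpa [Function.comp_def] using hρO.comp_tendsto hshift
  have h1' := h1.sqrt (Eventually.of_forall fun n => (A.δ_pos n).le)
  have h2' := h2.sqrt (Eventually.of_forall fun n => (A.δ_pos (n + 1)).le)
  -- The exponents add up to `D + (Δ - D) = Δ`, the two square roots contributing half of `Δ - D`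
  -- each.
  have hprod : (fun n : ℕ => ((n : ℝ) + 1) ^ Δ) =O[atTop]
      (fun n => A.ρ (n + 1) * (√(A.δ (n + 1)) * √(A.δ (n + 2)))) := by
    refine (h3.mul (h1'.mul h2')).congr_left fun n => ?_
    rw [Real.mul_self_sqrt (by positivity), ← Real.rpow_add (by positivity)]
    ring_nf
  have hinv := hprod.inv_rev (Eventually.of_forall fun n h =>
    absurd h (Real.rpow_pos_of_pos (by positivity) _).ne')
  refine (hinv.neg_left.congr_left fun n => (A.turn_e n).symm).congr_right fun n => ?_
  rw [Real.rpow_neg (by positivity)]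

end JacobiMatrix

end

theorem proposition5 (A : JacobiMatrix) (Δ D C c : ℝ) (hC : 0 < C) (hc : 0 < c)
    (hΔ : 1 < Δ) (hΔD : Δ < D - 1)
    (hPQ : (fun n : ℕ => ((A.P n).eval 0) ^ 2 + ((A.Q n).eval 0) ^ 2)
      ~[atTop] (fun n : ℕ => C * (n : ℝ) ^ (Δ - D)))
    (hρ : A.ρ ~[atTop] (fun n : ℕ => c * (n : ℝ) ^ D)) :
    Summable A.δ ∧
    (∃ M, CanonicalSystem.IsMonodromyMatrix A.hamiltonian A.L M) ∧
    ∀ M, CanonicalSystem.IsMonodromyMatrix A.hamiltonian A.L M →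
      ∀ i j : Fin 2, growthOrder (fun z => M A.L z i j) ≤ ((1 / D : ℝ) : EReal) := by
  have hδ : A.δ ~[atTop] (fun n : ℕ => C * (n : ℝ) ^ (Δ - D)) := hPQ
  have hδO : A.δ =O[atTop] (fun n : ℕ => (n : ℝ) ^ (Δ - D)) :=
    hδ.isBigO.trans (isBigO_const_mul_self C _ _)
  have hsum : Summable A.δ :=
    summable_of_isBigO_nat (Real.summable_nat_rpow.2 (by linarith)) hδO
  have hs : Summable (fun n => A.δ (n + 1)) := (summable_nat_add_iff 1).2 hsum
  have hv : ∀ n, A.e (n + 1) 0 ^ 2 + A.e (n + 1) 1 ^ 2 = 1 := A.e_sq_add_sq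
  -- On `ℕ` an asymptotic bound holds at every index where the comparison function is nonzero, after
  -- enlarging the constant. The second bound is used only at `n + 1`, avoiding index `0`.
  obtain ⟨K₁, hK₁, h₁⟩ := bound_of_isBigO_nat_atTop (A.turn_e_isBigO hC hc (by linarith) hδ hρ)
  obtain ⟨K₂, hK₂, h₂⟩ := bound_of_isBigO_nat_atTop hδO
  have hpos : ∀ (n : ℕ) (s : ℝ), 0 < ((n : ℝ) + 1) ^ s := fun n s => by positivity
  have hturn : ∀ n, |CanonicalSystem.turn (fun n => A.e (n + 1)) n| ≤
      (K₁ + K₂) * ((n : ℝ) + 1) ^ (-Δ) := by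
    intro n
    have h := h₁ (hpos n (-Δ)).ne'
    rw [Real.norm_eq_abs, Real.norm_of_nonneg (hpos n _).le] at h
    nlinarith [mul_pos hK₂ (hpos n (-Δ))]
  have hlen : ∀ n, A.δ (n + 1) ≤ (K₁ + K₂) * ((n : ℝ) + 1) ^ (-(D - Δ)) := by
    intro n
    have hp := hpos n (Δ - D)
    have h := h₂ (x := n + 1) (by push_cast; exact hp.ne')
    push_cast at h
    rw [Real.norm_of_nonneg (A.δ_pos n).le, Real.norm_of_nonneg hp.le] at h
    rw [neg_sub]
    nlinarith [mul_pos hK₁ hp]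
  rw [A.hamiltonian_eq]
  exact ⟨hsum, CanonicalSystem.exists_isMonodromyMatrix_stepHamiltonian hv A.δ_pos hs,
    fun M hM => hM.growthOrder_le hv A.δ_pos hs hΔ hΔD (add_pos hK₁ hK₂) hturn hlen⟩
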